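/- For a set $\Gamma$ and $0<q<\infty$ let $\ell_q(\Gamma)$ be the vector space of all $x\colon\Gamma\to\mathbb{R}$ with $\|x\|_q:=\big(\sum_{\gamma\in\Gamma}|x(\gamma)|^q\big)^{1/q}<\infty$; for $1\le p<\infty$ the Banach space $\ell_p(\Gamma)$ carries the norm $\|\cdot\|_p$, and $\mathcal{Y}_p:=\bigcup_{0<q<p}\ell_q(\Gamma)$, a linear subspace of $\ell_p(\Gamma)$. Let $\ell_\infty$ be the Banach space of bounded real sequences $(x(j))_{j\ge1}$ with the supremum norm. A normed space is an *operator range* if it is the image of a Banach space under a bounded linear operator. A norm on a real normed space $X$ is *$C^\infty$-smooth* if it is infinitely many times continuously Fréchet differentiable on $X\setminus\{0\}$. A norm $N$ on $X$ is *LFC* (locally depends on finitely many coordinates) if for every $x\in X\setminus\{0\}$ there are an open neighbourhood $U$ of $x$, continuous linear functionals $\varphi_1,\dots,\varphi_k\in X^*$ and a $C^\infty$-smooth function $G\colon\mathbb{R}^k\to\mathbb{R}$ such that $N(y)=G(\varphi_1(y),\dots,\varphi_k(y))$ for all $y\in U$. Subspaces of $\ell_p(\Gamma)$ are normed by $\|\cdot\|_p$.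 **Theorem.** Let $\Gamma$ be a set and $1\le p<\infty$. (i) If $p>1$, or if $p=1$ and $\Gamma$ is countable, then $\ell_p(\Gamma)$ contains a dense linear subspace $R\subseteq\mathcal{Y}_p$ that is an operator range and admits a $C^\infty$-smooth and LFC norm equivalent to $\|\cdot\|_p$ on $R$. (ii) If $p>1$, then the inclusion $x\mapsto x$ is an injective bounded linear operator from $\ell_1(\Gamma)$ to $\ell_p(\Gamma)$, and its range is contained in $\mathcal{Y}_p$, is dense in $\ell_p(\Gamma)$, is an operator range, and admits a $C^\infty$-smooth and LFC norm equivalent to $\|\cdot\|_p$ on it. (iii) $\ell_{1/2}(\Gamma)\subseteq\mathcal{Y}_1$. If $\Gamma$ is countably infinite and $\Gamma=\{\gamma_j\colon j\ge1\}$ is any enumeration without repetitions, then $T\colon\ell_\infty\to\ell_1(\Gamma)$, $(Tx)(\gamma_j):=2^{-j}x(j)$, is an injective bounded linear operator, and its range is contained in $\ell_{1/2}(\Gamma)\subseteq\mathcal{Y}_1$, is dense in $\ell_1(\Gamma)$, is an operator range, and admits a $C^\infty$-smooth and LFC norm equivalent to $\|\cdot\|_1$ on it. -/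

import Mathlib

open scoped ContDiff

universe u

/-- The vector space `𝒴_p = ⋃_{0 < q < p} ℓ_q(Γ)`, as a linear subspace of the real Banach space
`ℓ_p(Γ)`, where `1 ≤ p`. -/
def calY (Γ : Type u) (p : ENNReal) [hp : Fact (1 ≤ p)] :
    Submodule ℝ (lp (fun _ : Γ => ℝ) p) where
  carrier := {y | ∃ q : ENNReal, 0 < q ∧ q < p ∧ Memℓp (y : Γ → ℝ) q}
  zero_mem' := ⟨2⁻¹, by simp, lt_of_lt_of_le (by norm_num) hp.out, zero_memℓp⟩
  add_mem' := by
    rintro a b ⟨q, h0, hq, ha⟩ ⟨r, h0', hr, hb⟩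
    refine ⟨max q r, lt_max_of_lt_left h0, max_lt hq hr, ?_⟩
    exact (ha.of_exponent_ge (le_max_left q r)).add (hb.of_exponent_ge (le_max_right q r))
  smul_mem' := by
    rintro c a ⟨q, h0, hq, ha⟩
    exact ⟨q, h0, hq, ha.const_smul c⟩

/-- A normed space `Y` is an operator range if it is the image of a Banach space under a bounded
linear operator. Letting the Banach space `Z` live in the universe of `Y` is no restriction:
`Z` may be replaced by its quotient by the kernel of `T`, which is in bijection with `Y`. -/
def IsOperatorRange (Y : Type u) [NormedAddCommGroup Y] [NormedSpace ℝ Y] : Prop :=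
  ∃ (Z : Type u) (_ : NormedAddCommGroup Z) (_ : NormedSpace ℝ Z) (_ : CompleteSpace Z)
    (T : Z →L[ℝ] Y), Function.Surjective T

section Norms

variable {X : Type u} [NormedAddCommGroup X] [NormedSpace ℝ X]

/-- `N` is a norm on `X` equivalent to the given one. -/
def IsEquivalentNorm (N : Seminorm ℝ X) : Prop :=
  ∃ c C : ℝ, 0 < c ∧ 0 < C ∧ ∀ x : X, c * ‖x‖ ≤ N x ∧ N x ≤ C * ‖x‖

/-- `N` is `C^∞`-smooth away from the origin. -/
def IsCInftySmoothNorm (N : Seminorm ℝ X) : Prop :=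
  ContDiffOn ℝ ∞ (fun x : X => N x) {x : X | x ≠ 0}

/-- `N` locally depends on finitely many coordinates: near every nonzero point it is a
`C^∞`-smooth function of finitely many continuous linear functionals. -/
def IsLFCNorm (N : Seminorm ℝ X) : Prop :=
  ∀ x : X, x ≠ 0 → ∃ U : Set X, IsOpen U ∧ x ∈ U ∧
    ∃ (k : ℕ) (φ : Fin k → (X →L[ℝ] ℝ)) (G : (Fin k → ℝ) → ℝ), ContDiff ℝ ∞ G ∧
      ∀ y ∈ U, N y = G (fun i => φ i y)

end Norms

/-- The normed space `X` admits an equivalent norm that is `C^∞`-smooth and LFC. -/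
def AdmitsSmoothLFCNorm (X : Type u) [NormedAddCommGroup X] [NormedSpace ℝ X] : Prop :=
  ∃ N : Seminorm ℝ X, IsEquivalentNorm N ∧ IsCInftySmoothNorm N ∧ IsLFCNorm N

/-! Any subspace `R` of 𝒴_p, with P = p, carries such a norm; the operators in (i)-(iii) only supply
dense operator ranges inside 𝒴_p. Choose c_0 < d_0 < c_1 < d_1 < ... → 1 and, for each finite A ⊆ Γ
with n elements, a smooth convex φ_A that vanishes while a smoothed ∑_{A} |x(γ)|^P is at most c_n
and exceeds 1 once it reaches d_n. The unit ball of the new norm is {∑_A φ_A ≤ 1}. If all φ_A(y) ≤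
1, every n-element power sum of y is at most d_n. Since y ∈ ℓ_q with q < P and d_n → 1 more slowly
than any power, ‖y‖ < 1 strictly (`tsum_rpow_lt_one_of_slowlyToOne`). Then a finite E carries almost
all the mass of y: a set A ⊄ E with m + 1 elements has at most m of them in E, so its power sum near
y is little more than d_m, hence below c_{m+1}, and φ_A = 0 there (`eventually_sum_rpow_le`). So
near each of its points the ball is a sublevel set of a finite sum of the φ_A, and the implicit
function theorem along rays makes its gauge smooth and LFC
(`admitsSmoothLFCNorm_of_local_sublevel`). -/

open Set Filter Topology

/-! ### Solving g(tv) = 1 along rays -/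

section ImplicitFunction

variable {E : Type*} [NormedAddCommGroup E] [NormedSpace ℝ E] [FiniteDimensional ℝ E]

/-- The derivative is block triangular, with the identity and the nonzero radial derivative on the
diagonal; it is injective, hence invertible in finite dimension. -/
theorem hasFDerivAt_prodMk_comp_smul {g : E → ℝ} (hg : ContDiff ℝ ∞ g) (p : E × ℝ)
    (h : fderiv ℝ g (p.2 • p.1) p.1 ≠ 0) :
    ∃ D : (E × ℝ) ≃L[ℝ] (E × ℝ),
      HasFDerivAt (fun p : E × ℝ => (p.1, g (p.2 • p.1))) (D : (E × ℝ) →L[ℝ] (E × ℝ)) p := by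
  have hd : HasFDerivAt g (fderiv ℝ g (p.2 • p.1)) (p.2 • p.1) :=
    (hg.differentiable (by simp) _).hasFDerivAt
  have hs : HasFDerivAt (fun p : E × ℝ => p.2 • p.1) _ p :=
    (hasFDerivAt_snd (𝕜 := ℝ) (p := p)).smul (hasFDerivAt_fst (𝕜 := ℝ) (p := p))
  have hF := (hasFDerivAt_fst (𝕜 := ℝ) (p := p)).prodMk (hd.comp p hs)
  generalize hD : (ContinuousLinearMap.prod _ _ : (E × ℝ) →L[ℝ] (E × ℝ)) = D at hF
  have hinj : Function.Injective (D : (E × ℝ) →ₗ[ℝ] (E × ℝ)) := by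
    rw [← LinearMap.ker_eq_bot, LinearMap.ker_eq_bot']
    rintro ⟨v, t⟩ hv
    subst hD
    simp at hv
    obtain ⟨rfl, hv⟩ := hv
    simp at hv
    rcases hv with hv | hv
    · simp [hv]
    · exact absurd hv h
  refine ⟨(LinearEquiv.ofInjectiveEndo _ hinj).toContinuousLinearEquiv, ?_⟩
  have e : ((LinearEquiv.ofInjectiveEndo _ hinj).toContinuousLinearEquiv :
      (E × ℝ) →L[ℝ] (E × ℝ)) = D := ContinuousLinearMap.ext fun _ => rfl
  rw [e]
  exact hF

/-- A smooth function agrees near a point with a function that is smooth everywhere. -/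
theorem exists_contDiff_eventuallyEq {f : E → ℝ} {V : Set E} (hV : IsOpen V) {u : E} (hu : u ∈ V)
    (hf : ContDiffOn ℝ ∞ f V) : ∃ M : E → ℝ, ContDiff ℝ ∞ M ∧ M =ᶠ[𝓝 u] f := by
  obtain ⟨r, hr, hrV⟩ := Metric.isOpen_iff.1 hV u hu
  let b : ContDiffBump u := ⟨r / 4, r / 2, by positivity, by linarith⟩
  refine ⟨fun x => b x * f x, ?_, ?_⟩
  · rw [contDiff_iff_contDiffAt]
    intro x
    by_cases hx : x ∈ V
    · exact b.contDiffAt.mul (hf.contDiffAt (hV.mem_nhds hx))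
    · have : x ∉ tsupport b := by
        rw [b.tsupport_eq]
        intro hx'
        refine hx (hrV ?_)
        rw [Metric.mem_closedBall] at hx'
        exact lt_of_le_of_lt hx' (show r / 2 < r by linarith)
      have h0 : (fun x => b x * f x) =ᶠ[𝓝 x] fun _ => 0 := by
        have := notMem_tsupport_iff_eventuallyEq.1 this
        filter_upwards [this] with y hy
        simp [hy]
      exact contDiffAt_const.congr_of_eventuallyEq h0
  · filter_upwards [b.eventuallyEq_one] with x hx
    simp [hx]

/-- Locally inverting (v, t) ↦ (v, g(tv)) at (u, 1) yields t(v) with g(t(v)v) = 1; `M` is 1/t near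
`u`, the candidate for the gauge of {g ≤ 1}. -/
theorem exists_contDiff_radial_implicit {g : E → ℝ} (hg : ContDiff ℝ ∞ g) {u : E} (hu : g u = 1)
    (hd : fderiv ℝ g u u ≠ 0) :
    ∃ M : E → ℝ, ContDiff ℝ ∞ M ∧ M u = 1 ∧ ∀ᶠ v in 𝓝 u, g ((M v)⁻¹ • v) = 1 := by
  set f : E × ℝ → E × ℝ := fun p => (p.1, g (p.2 • p.1)) with hf
  have hfc : ContDiff ℝ ∞ f :=
    contDiff_fst.prodMk (hg.comp (contDiff_snd.smul contDiff_fst))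
  have hfu : f (u, 1) = (u, 1) := by simp [hf, hu]
  obtain ⟨D, hD⟩ := hasFDerivAt_prodMk_comp_smul hg (u, (1 : ℝ)) (by simpa using hd)
  set F := hfc.contDiffAt.toOpenPartialHomeomorph f hD (by simp) with hF
  have hFf : ∀ p, F p = f p := fun p => rfl
  have hsrc : (u, (1 : ℝ)) ∈ F.source := hfc.contDiffAt.mem_toOpenPartialHomeomorph_source hD (by simp)
  have htgt : (u, (1 : ℝ)) ∈ F.target := by
    have := F.map_source hsrc
    rwa [hFf, hfu] at this
  have hsymm : F.symm (u, 1) = (u, 1) := by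
    conv_lhs => rw [← hfu, ← hFf]
    exact F.left_inv hsrc
  -- The local inverse is known to be smooth only where the derivative is invertible; `O` is the
  -- open set where this holds and 1/t is defined.
  let O : Set (E × ℝ) := {p | fderiv ℝ g (p.2 • p.1) p.1 ≠ 0 ∧ p.2 ≠ 0}
  have hO : IsOpen O := by
    have h1 : Continuous fun p : E × ℝ => fderiv ℝ g (p.2 • p.1) p.1 :=
      ((hg.continuous_fderiv (by simp)).comp (continuous_snd.smul continuous_fst)).clm_apply
        continuous_fst
    exact (isOpen_ne_fun h1 continuous_const).inter (isOpen_ne_fun continuous_snd continuous_const)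
  have hW : IsOpen (F.target ∩ F.symm ⁻¹' O) := F.symm.isOpen_inter_preimage hO
  let V : Set E := (fun v => (v, (1 : ℝ))) ⁻¹' (F.target ∩ F.symm ⁻¹' O)
  have hV : IsOpen V := hW.preimage (by fun_prop)
  have huV : u ∈ V := ⟨htgt, by simp only [mem_preimage, hsymm]; exact ⟨by simpa using hd, by simp⟩⟩
  have hG : ContDiffOn ℝ ∞ (fun v => ((F.symm (v, 1)).2)⁻¹) V := by
    intro v hv
    obtain ⟨D', hD'⟩ := hasFDerivAt_prodMk_comp_smul hg (F.symm (v, (1 : ℝ))) hv.2.1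
    have hs : ContDiffAt ℝ ∞ (fun v => F.symm (v, 1)) v :=
      (F.contDiffAt_symm hv.1 hD' hfc.contDiffAt).comp v (contDiffAt_id.prodMk contDiffAt_const)
    exact (hs.snd.inv hv.2.2).contDiffWithinAt
  -- The LFC property asks for a function smooth on the whole space, hence the cutoff.
  obtain ⟨M, hM, hMe⟩ := exists_contDiff_eventuallyEq hV huV hG
  refine ⟨M, hM, by rw [hMe.self_of_nhds]; simp [hsymm], ?_⟩
  filter_upwards [hMe, hV.mem_nhds huV] with v hv hvV
  have h := F.right_inv hvV.1
  rw [hFf] at h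
  obtain ⟨h1, h2⟩ := Prod.ext_iff.1 h
  simp only [hf] at h1 h2
  rw [hv, inv_inv]
  rw [h1] at h2
  exact h2

end ImplicitFunction

/-! ### Gauges of bodies that are locally smooth sublevel sets -/

section Factorization

variable {X : Type u} [NormedAddCommGroup X] [NormedSpace ℝ X]

/-- `f` is a `C^∞`-smooth function of finitely many continuous linear functionals. -/
def FactorsSmoothly (f : X → ℝ) : Prop :=
  ∃ (E : Type) (_ : NormedAddCommGroup E) (_ : NormedSpace ℝ E) (_ : FiniteDimensional ℝ E)
    (L : X →L[ℝ] E) (g : E → ℝ), ContDiff ℝ ∞ g ∧ ∀ x, f x = g (L x)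

namespace FactorsSmoothly

theorem clm (l : X →L[ℝ] ℝ) : FactorsSmoothly fun x => l x :=
  ⟨ℝ, _, _, inferInstance, l, id, contDiff_id, fun _ => rfl⟩

theorem comp {f : X → ℝ} (hf : FactorsSmoothly f) {h : ℝ → ℝ} (hh : ContDiff ℝ ∞ h) :
    FactorsSmoothly fun x => h (f x) := by
  obtain ⟨E, _, _, _, L, g, hg, hfg⟩ := hf
  exact ⟨E, _, _, inferInstance, L, h ∘ g, hh.comp hg, fun x => by simp [hfg]⟩

theorem add {f₁ f₂ : X → ℝ} (h₁ : FactorsSmoothly f₁) (h₂ : FactorsSmoothly f₂) :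
    FactorsSmoothly fun x => f₁ x + f₂ x := by
  obtain ⟨E₁, _, _, _, L₁, g₁, hg₁, hfg₁⟩ := h₁
  obtain ⟨E₂, _, _, _, L₂, g₂, hg₂, hfg₂⟩ := h₂
  exact ⟨E₁ × E₂, _, _, inferInstance, L₁.prod L₂, fun p => g₁ p.1 + g₂ p.2,
    (hg₁.comp contDiff_fst).add (hg₂.comp contDiff_snd), fun x => by simp [hfg₁, hfg₂]⟩

theorem sum {ι : Type*} {f : ι → X → ℝ} (s : Finset ι) (h : ∀ i ∈ s, FactorsSmoothly (f i)) :
    FactorsSmoothly fun x => ∑ i ∈ s, f i x := by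
  classical
  induction s using Finset.induction_on with
  | empty => exact ⟨ℝ, _, _, inferInstance, 0, fun _ => 0, contDiff_const, fun x => by simp⟩
  | insert i s hi ih =>
    simp only [Finset.sum_insert hi]
    exact (h i (by simp)).add (ih fun j hj => h j (by simp [hj]))

theorem continuous {f : X → ℝ} (hf : FactorsSmoothly f) : Continuous f := by
  obtain ⟨E, _, _, _, L, g, hg, hfg⟩ := hf
  rw [funext hfg]
  exact hg.continuous.comp L.continuous

end FactorsSmoothly

theorem IsLFCNorm.isCInftySmoothNorm {N : Seminorm ℝ X} (hN : IsLFCNorm N) :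
    IsCInftySmoothNorm N := by
  intro x hx
  obtain ⟨U, hU, hxU, k, φ, G, hG, hNG⟩ := hN x hx
  have h : ContDiff ℝ ∞ fun y => G fun i => φ i y :=
    hG.comp (contDiff_pi.2 fun i => (φ i).contDiff)
  refine (h.contDiffAt.congr_of_eventuallyEq ?_).contDiffWithinAt
  filter_upwards [hU.mem_nhds hxU] with y hy using hNG y hy

/-- The gauge of a bounded closed convex symmetric neighbourhood of the origin which near each of
its points is a sublevel set of a smooth convex function of finitely many functionals. -/
theorem admitsSmoothLFCNorm_of_local_sublevel {B : Set X} (hBc : Convex ℝ B) (hBcl : IsClosed B)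
    (hBneg : ∀ x ∈ B, -x ∈ B) (hB0 : B ∈ 𝓝 0) (hBb : ∀ x ∈ B, ‖x‖ ≤ 1)
    (hloc : ∀ y ∈ B, ∃ Ψ : X → ℝ, FactorsSmoothly Ψ ∧ ConvexOn ℝ univ Ψ ∧ Ψ 0 = 0 ∧
      (∀ z ∈ B, Ψ z ≤ 1) ∧ ∀ᶠ z in 𝓝 y, Ψ z ≤ 1 → z ∈ B) :
    AdmitsSmoothLFCNorm X := by
  have h0B : (0 : X) ∈ B := mem_of_mem_nhds hB0
  have habs : Absorbent ℝ B := absorbent_nhds_zero hB0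
  have hbal : Balanced ℝ B := by
    rw [balanced_iff_neg_mem hBc]
    exact fun {x} hx => hBneg x hx
  let N : Seminorm ℝ X := gaugeSeminorm hbal hBc habs
  have hN : ∀ x, N x = gauge B x := fun x => rfl
  have hNlow : ∀ x, ‖x‖ ≤ N x := by
    intro x
    have := le_gauge_of_subset_closedBall (x := x) habs zero_le_one
      (fun z hz => by simpa using hBb z hz)
    simpa [hN] using this
  obtain ⟨c, hc, hcB⟩ := Metric.mem_nhds_iff.1 hB0
  have hNup : ∀ x, N x ≤ c⁻¹ * ‖x‖ := by
    intro x
    have := mul_gauge_le_norm (x := x) hcB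
    rw [hN, inv_mul_eq_div, le_div_iff₀ hc, mul_comm]
    exact this
  -- x is the convex combination of s • x and 0 with weight 1/s on s • x.
  have hgrow : ∀ Ψ : X → ℝ, ConvexOn ℝ univ Ψ → Ψ 0 = 0 → ∀ x, Ψ x = 1 → ∀ s : ℝ, 1 ≤ s →
      s ≤ Ψ (s • x) := by
    intro Ψ hΨ hΨ0 x hx s hs
    have hs0 : 0 < s := by linarith
    have := hΨ.2 (mem_univ (s • x)) (mem_univ 0) (inv_nonneg.2 hs0.le)
      (sub_nonneg.2 (inv_le_one_of_one_le₀ hs)) (by ring)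
    rw [smul_smul, inv_mul_cancel₀ hs0.ne', one_smul, smul_zero, add_zero, hx, hΨ0, smul_zero,
      add_zero, smul_eq_mul, inv_mul_eq_div, le_div_iff₀ hs0] at this
    linarith
  have hLFC : IsLFCNorm N := by
    intro y hy
    have hNy : 0 < N y := (norm_pos_iff.2 hy).trans_le (hNlow y)
    set x := (N y)⁻¹ • y with hx
    have hNx : N x = 1 := by
      rw [hx, map_smul_eq_mul, norm_inv, Real.norm_of_nonneg hNy.le, inv_mul_cancel₀ hNy.ne']
    have hxB : x ∈ B := by
      rw [← hBcl.closure_eq]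
      exact mem_closure_of_gauge_le_one hBc h0B habs hNx.le
    obtain ⟨Ψ, hΨs, hΨc, hΨ0, hΨB, hΨloc⟩ := hloc x hxB
    -- Were Ψ x < 1, a neighbourhood of x would lie in B, contradicting gauge 1.
    have hΨx : Ψ x = 1 := by
      refine le_antisymm (hΨB x hxB) (not_lt.1 fun hlt => ?_)
      have : B ∈ 𝓝 x := by
        filter_upwards [hΨloc, hΨs.continuous.continuousAt.eventually_lt_const hlt] with z hz hz'
        exact hz hz'.le
      exact ((gauge_lt_one_iff_mem_interior hBc hB0).2 (mem_interior_iff_mem_nhds.2 this)).ne hNx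
    -- A point of gauge below 1 could be dilated within B, where Ψ would then exceed 1.
    have hone : ∀ w ∈ B, Ψ w = 1 → N w = 1 := by
      intro w hw hΨw
      refine le_antisymm (gauge_le_one_of_mem hw) (not_lt.1 fun hlt => ?_)
      obtain ⟨b, hb0, hb1, hb⟩ := exists_lt_of_gauge_lt habs hlt
      obtain ⟨v, hv, rfl⟩ := hb
      have hv' := hgrow Ψ hΨc hΨ0 _ hΨw b⁻¹ ((one_le_inv₀ hb0).2 hb1.le)
      simp only [smul_smul, inv_mul_cancel₀ hb0.ne', one_smul] at hv'
      have := hΨB v hv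
      have := (one_lt_inv₀ hb0).2 hb1
      linarith
    obtain ⟨E, _, _, _, L, g, hg, hΨg⟩ := hΨs
    have hgu : g (L x) = 1 := by rw [← hΨg, hΨx]
    -- Along the ray, Ψ is convex and rises from 0 to 1 on [0, 1], so its derivative at 1 is at
    -- least 1.
    have hd : fderiv ℝ g (L x) (L x) ≠ 0 := by
      intro h0
      have hder : HasDerivAt (fun t : ℝ => Ψ (t • x)) 0 1 := by
        have h1 : HasDerivAt (fun t : ℝ => t • L x) (L x) 1 := by
          simpa using (hasDerivAt_id (1 : ℝ)).smul_const (L x)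
        have h2 : HasFDerivAt g (fderiv ℝ g (L x)) ((1 : ℝ) • L x) := by
          rw [one_smul]
          exact (hg.differentiable (by simp) _).hasFDerivAt
        have := h2.comp_hasDerivAt (1 : ℝ) h1
        rw [h0] at this
        exact this.congr_of_eventuallyEq (Eventually.of_forall fun t => by simp [hΨg])
      have hcv : ConvexOn ℝ univ fun t : ℝ => Ψ (t • x) := by
        exact hΨc.comp_linearMap (LinearMap.toSpanSingleton ℝ X x)
      have := hcv.slope_le_of_hasDerivAt (mem_univ 0) (mem_univ 1) zero_lt_one hder
      simp [slope, hΨ0, hΨx] at this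
      linarith
    obtain ⟨M, hM, hMu, hMg⟩ := exists_contDiff_radial_implicit hg hgu hd
    have hML : ContinuousAt (fun z => M (L z)) x :=
      (hM.continuous.comp L.continuous).continuousAt
    -- Dividing z by M (L z) lands near x on {Ψ = 1}, hence in B with gauge 1; homogeneity then
    -- gives N z.
    have hNM : ∀ᶠ z in 𝓝 x, N z = M (L z) := by
      have hw : Tendsto (fun z => (M (L z))⁻¹ • z) (𝓝 x) (𝓝 x) := by
        have : Tendsto (fun z => (M (L z))⁻¹ • z) (𝓝 x) (𝓝 ((M (L x))⁻¹ • x)) :=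
          ((hML.inv₀ (by simp [hMu])).smul continuousAt_id)
        simpa [hMu] using this
      have hpos : ∀ᶠ z in 𝓝 x, 0 < M (L z) := hML.eventually_const_lt (by simp [hMu])
      filter_upwards [hpos, hw.eventually hΨloc, L.continuous.continuousAt.eventually hMg]
        with z hz1 hz2 hz3
      have hΨw : Ψ ((M (L z))⁻¹ • z) = 1 := by rw [hΨg, map_smul, hz3]
      have := hone _ (hz2 hΨw.le) hΨw
      rw [map_smul_eq_mul, norm_inv, Real.norm_of_nonneg hz1.le, inv_mul_eq_div,
        div_eq_one_iff_eq hz1.ne'] at this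
      exact this
    have hcont : Tendsto (fun z => (N y)⁻¹ • z) (𝓝 y) (𝓝 x) :=
      (continuous_const_smul _).continuousAt
    obtain ⟨U, hU, hUo, hyU⟩ := eventually_nhds_iff.1 (hcont.eventually hNM)
    let e := (Module.finBasis ℝ E).equivFunL
    refine ⟨U, hUo, hyU, _, fun i => (ContinuousLinearMap.proj (R := ℝ)
      (φ := fun _ : Fin (Module.finrank ℝ E) => ℝ) i).comp ((e : E →L[ℝ] _).comp L), fun v => N y * M ((N y)⁻¹ • e.symm v), ?_, ?_⟩
    · exact contDiff_const.mul (hM.comp (contDiff_const.smul e.symm.contDiff))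
    · intro z hz
      have h1 := hU z hz
      rw [map_smul_eq_mul, norm_inv, Real.norm_of_nonneg hNy.le, inv_mul_eq_div,
        div_eq_iff hNy.ne', map_smul] at h1
      have h2 : e.symm (fun i => (ContinuousLinearMap.proj (R := ℝ)
          (φ := fun _ : Fin (Module.finrank ℝ E) => ℝ) i).comp ((e : E →L[ℝ] _).comp L) z) = L z := e.symm_apply_apply (L z)
      simp only [h2]
      rw [h1, mul_comm]
  exact ⟨N, ⟨1, c⁻¹, one_pos, inv_pos.2 hc, fun x => ⟨by simpa using hNlow x, hNup x⟩⟩,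
    hLFC.isCInftySmoothNorm, hLFC⟩

/-- The body is {∑ φ_i ≤ 1}. A sum, unlike a supremum, stays smooth, and by `hloc` it is a finite
sum near each point of the body. -/
theorem admitsSmoothLFCNorm_of_family {ι : Type*} (φ : ι → X → ℝ)
    (hconv : ∀ i, ConvexOn ℝ univ (φ i)) (heven : ∀ i x, φ i (-x) = φ i x)
    (hzero : ∀ i, φ i 0 = 0) (hnonneg : ∀ i x, 0 ≤ φ i x) (hsm : ∀ i, FactorsSmoothly (φ i))
    (hloc : ∀ y, (∀ i, φ i y ≤ 1) → ∃ F : Finset ι, ∀ᶠ z in 𝓝 y, ∀ i ∉ F, φ i z = 0)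
    (hbdd : ∀ y, (∀ i, φ i y ≤ 1) → ‖y‖ ≤ 1) : AdmitsSmoothLFCNorm X := by
  classical
  let S : Finset ι → X → ℝ := fun F x => ∑ i ∈ F, φ i x
  have hSc : ∀ F, ConvexOn ℝ univ (S F) := by
    intro F
    induction F using Finset.induction_on with
    | empty => simpa [S] using convexOn_const (0 : ℝ) convex_univ
    | insert i F hi ih =>
      have e : S (insert i F) = φ i + S F := by
        funext x
        simp [S, Finset.sum_insert hi]
      rw [e]
      exact (hconv i).add ih
  have hSs : ∀ F, FactorsSmoothly (S F) := fun F => FactorsSmoothly.sum F fun i _ => hsm i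
  have hS0 : ∀ F, S F 0 = 0 := fun F => by simp [S, hzero]
  -- Bounding all finite partial sums avoids any summability question away from B.
  let B : Set X := {y | ∀ F, S F y ≤ 1}
  have hBle : ∀ y ∈ B, ∀ i, φ i y ≤ 1 := fun y hy i => by simpa [S] using hy {i}
  have hB : ∀ y ∈ B, ∃ F, ∀ᶠ z in 𝓝 y, S F z ≤ 1 → z ∈ B := by
    intro y hy
    obtain ⟨F, hF⟩ := hloc y (hBle y hy)
    refine ⟨F, hF.mono fun z hz hz1 F' => le_trans ?_ hz1⟩
    have : S F' z = ∑ i ∈ F' ∩ F, φ i z := by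
      refine (Finset.sum_subset Finset.inter_subset_left fun i hi hi' => hz i fun h => ?_).symm
      exact hi' (Finset.mem_inter.2 ⟨hi, h⟩)
    rw [this]
    exact Finset.sum_le_sum_of_subset_of_nonneg Finset.inter_subset_right
      fun i _ _ => hnonneg i z
  have h0B : (0 : X) ∈ B := fun F => by simp [hS0]
  refine admitsSmoothLFCNorm_of_local_sublevel (B := B) ?_ ?_ ?_ ?_ ?_ ?_
  · have : B = ⋂ F, {y ∈ univ | S F y ≤ 1} := by ext; simp [B]
    rw [this]
    exact convex_iInter fun F => (hSc F).convex_le 1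
  · have : B = ⋂ F, {y | S F y ≤ 1} := by ext; simp [B]
    rw [this]
    exact isClosed_iInter fun F => isClosed_le (hSs F).continuous continuous_const
  · intro x hx F
    simpa [S, heven] using hx F
  · obtain ⟨F, hF⟩ := hB 0 h0B
    filter_upwards [hF, (hSs F).continuous.continuousAt.eventually_lt_const
      (show S F 0 < 1 by simp [hS0])] with z hz hz'
    exact hz hz'.le
  · exact fun y hy => hbdd y (hBle y hy)
  · intro y hy
    obtain ⟨F, hF⟩ := hB y hy
    exact ⟨S F, hSs F, hSc F, hS0 F, fun z hz => hz F, hF⟩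

end Factorization

/-! ### Smooth convex functions on the line -/

/-- A smooth monotone convex function vanishing exactly on the nonpositive half-line. -/
theorem exists_smooth_convex_cutoff : ∃ ψ : ℝ → ℝ, ContDiff ℝ ∞ ψ ∧ Monotone ψ ∧
    ConvexOn ℝ univ ψ ∧ (∀ s ≤ 0, ψ s = 0) ∧ ∀ s, 0 < s → 0 < ψ s := by
  have hc : Continuous expNegInvGlue := expNegInvGlue.contDiff (n := 0).continuous
  set ψ : ℝ → ℝ := fun s => ∫ t in (0 : ℝ)..s, expNegInvGlue t with hψ
  have hder : ∀ s, HasDerivAt ψ (expNegInvGlue s) s := fun s =>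
    intervalIntegral.integral_hasDerivAt_right (hc.intervalIntegrable _ _)
      hc.aestronglyMeasurable.stronglyMeasurableAtFilter hc.continuousAt
  have hdiff : Differentiable ℝ ψ := fun s => (hder s).differentiableAt
  have hd : deriv ψ = expNegInvGlue := funext fun s => (hder s).deriv
  have hmonoglue : Monotone expNegInvGlue := by
    intro s t hst
    rcases le_or_gt s 0 with hs | hs
    · rw [expNegInvGlue.zero_of_nonpos hs]
      exact expNegInvGlue.nonneg t
    · simp only [expNegInvGlue, not_le.2 hs, not_le.2 (hs.trans_le hst), if_false]
      gcongr
  refine ⟨ψ, ?_, ?_, ?_, ?_, ?_⟩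
  · rw [contDiff_infty_iff_deriv, hd]
    exact ⟨hdiff, expNegInvGlue.contDiff⟩
  · refine monotone_of_deriv_nonneg hdiff fun s => ?_
    rw [hd]
    exact expNegInvGlue.nonneg s
  · refine Monotone.convexOn_univ_of_deriv hdiff ?_
    rw [hd]
    exact hmonoglue
  · intro s hs
    rw [hψ]
    refine intervalIntegral.integral_zero_ae (Eventually.of_forall fun t ht => ?_)
    rw [uIoc_of_ge hs] at ht
    exact expNegInvGlue.zero_of_nonpos ht.2
  · intro s hs
    exact intervalIntegral.intervalIntegral_pos_of_pos_on (hc.intervalIntegrable _ _)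
      (fun t ht => expNegInvGlue.pos_of_pos ht.1) hs

/-- Uniform approximation of `|t| ^ P` from above by smooth even convex functions. -/
theorem exists_smooth_convex_approx_rpow {P : ℝ} (hP : 1 ≤ P) {κ : ℝ} (hκ : 0 < κ) :
    ∃ h : ℝ → ℝ, ContDiff ℝ ∞ h ∧ ConvexOn ℝ univ h ∧ (∀ t, h (-t) = h t) ∧
      (∀ t, |t| ^ P ≤ h t) ∧ ∀ t, |t| ≤ 1 → h t ≤ |t| ^ P + κ := by
  have huc : UniformContinuousOn (fun x : ℝ => x ^ P) (Icc 0 2) :=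
    isCompact_Icc.uniformContinuousOn_of_continuous
      (Real.continuous_rpow_const (by linarith)).continuousOn
  obtain ⟨δ, hδ, hδκ⟩ := Metric.uniformContinuousOn_iff.1 huc κ hκ
  -- η < δ meets the modulus of continuity, and η ≤ 1 keeps |t| + η in [0, 2].
  set η := min (δ / 2) 1 with hη
  have hη0 : 0 < η := lt_min (by linarith) one_pos
  have hηδ : η < δ := (min_le_left _ _).trans_lt (by linarith)
  have hη1 : η ≤ 1 := min_le_right _ _
  have hP0 : 0 ≤ P := by linarith
  -- As the norm of a point depending affinely on t, the square root is convex in t.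
  have hnorm : ∀ t : ℝ, √(t ^ 2 + η ^ 2) = ‖(t + η * Complex.I : ℂ)‖ := fun t =>
    (Complex.norm_add_mul_I t η).symm
  refine ⟨fun t => √(t ^ 2 + η ^ 2) ^ P, ?_, ?_, ?_, ?_, ?_⟩
  · have hpos : ∀ t : ℝ, t ^ 2 + η ^ 2 ≠ 0 := fun t => by positivity
    exact ((((contDiff_id.pow 2).add contDiff_const).sqrt hpos)).rpow_const_of_ne
      fun t => (Real.sqrt_pos.2 (by positivity)).ne'
  · refine ⟨convex_univ, fun s _ t _ a b ha hb hab => ?_⟩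
    have h1 : √((a • s + b • t) ^ 2 + η ^ 2) ≤ a * √(s ^ 2 + η ^ 2) + b * √(t ^ 2 + η ^ 2) := by
      rw [hnorm, hnorm, hnorm]
      have : ((a • s + b • t : ℝ) + η * Complex.I : ℂ) =
          a • (s + η * Complex.I : ℂ) + b • (t + η * Complex.I : ℂ) := by
        have : (a : ℂ) + b = 1 := by exact_mod_cast hab
        simp only [smul_eq_mul, Complex.real_smul]
        push_cast
        linear_combination (- η * Complex.I) * this
      rw [this]
      refine (norm_add_le _ _).trans_eq ?_
      rw [norm_smul, norm_smul, Real.norm_of_nonneg ha, Real.norm_of_nonneg hb]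
    refine (Real.rpow_le_rpow (Real.sqrt_nonneg _) h1 hP0).trans ?_
    exact (convexOn_rpow hP).2 (Real.sqrt_nonneg _) (Real.sqrt_nonneg _) ha hb hab
  · intro t
    simp
  · intro t
    refine Real.rpow_le_rpow (abs_nonneg _) ?_ hP0
    rw [← Real.sqrt_sq_eq_abs]
    exact Real.sqrt_le_sqrt (by nlinarith)
  · intro t ht
    have h1 : √(t ^ 2 + η ^ 2) ≤ |t| + η := by
      rw [Real.sqrt_le_left (by positivity)]
      nlinarith [sq_abs t, mul_nonneg (abs_nonneg t) hη0.le]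
    have h2 := hδκ (|t| + η) ⟨by positivity, by linarith⟩ |t| ⟨abs_nonneg t, by linarith⟩
      (by simpa [Real.dist_eq, abs_of_pos hη0] using hηδ)
    rw [Real.dist_eq] at h2
    have h3 := Real.rpow_le_rpow (Real.sqrt_nonneg _) h1 hP0
    have h4 := (abs_lt.1 h2).2
    simp only at h4 ⊢
    linarith

/-! ### Thresholds tending slowly to one -/

/-- `d` tends to `1` more slowly than any power. -/
def SlowlyToOne (d : ℕ → ℝ) : Prop :=
  ∀ Q δ : ℝ, 0 ≤ Q → 0 < δ → ∃ N : ℝ, 0 < N ∧ ∀ n : ℕ, (n : ℝ) ≤ Q * N → Q * N ^ (-δ) < 1 - d n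

/-- Both sequences sample 1 - 1/log, since 1/log decays more slowly than any power; arguments from 3
> e on make log exceed 1, so the values are nonnegative. -/
theorem exists_interlacing_slowlyToOne : ∃ c d : ℕ → ℝ, (∀ n, 0 ≤ c n) ∧ (∀ n, c n < d n) ∧
    (∀ n, d n < c (n + 1)) ∧ (∀ n, d n < 1) ∧ Tendsto d atTop (𝓝 1) ∧ SlowlyToOne d := by
  have hlog1 : ∀ x : ℝ, 3 ≤ x → 1 < Real.log x := fun x hx => by
    rw [Real.lt_log_iff_exp_lt (by linarith)]
    linarith [Real.exp_one_lt_d9]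
  have hlt : ∀ x y : ℝ, 3 ≤ x → x < y → 1 - 1 / Real.log x < 1 - 1 / Real.log y := by
    intro x y hx hxy
    have := one_div_lt_one_div_of_lt (by linarith [hlog1 x hx])
      (Real.log_lt_log (by linarith) hxy)
    linarith
  refine ⟨fun n => 1 - 1 / Real.log (2 * n + 3), fun n => 1 - 1 / Real.log (2 * n + 4),
    fun n => ?_, fun n => hlt _ _ ?_ ?_, fun n => hlt _ _ ?_ ?_, fun n => ?_, ?_, ?_⟩
  · have := hlog1 (2 * n + 3) (by linarith [n.cast_nonneg (α := ℝ)])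
    have := (div_le_one (by linarith)).2 this.le
    linarith
  · linarith [n.cast_nonneg (α := ℝ)]
  · linarith
  · linarith [n.cast_nonneg (α := ℝ)]
  · push_cast; linarith
  · have := hlog1 (2 * n + 4) (by linarith [n.cast_nonneg (α := ℝ)])
    have : 0 < 1 / Real.log (2 * n + 4) := by positivity
    linarith
  · have h : Tendsto (fun n : ℕ => Real.log (2 * (n : ℝ) + 4)) atTop atTop :=
      Real.tendsto_log_atTop.comp (tendsto_atTop_add_const_right _ _
        (tendsto_natCast_atTop_atTop.const_mul_atTop two_pos))
    simpa using (tendsto_inv_atTop_zero.comp h).const_sub 1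
  · intro Q δ hQ hδ
    have h1 : Tendsto (fun N : ℝ => Q * (N ^ (-δ) * Real.log (2 * Q + 4) + Real.log N / N ^ δ))
        atTop (𝓝 0) := by
      have ha := (tendsto_rpow_neg_atTop hδ).mul_const (Real.log (2 * Q + 4))
      have hb := (isLittleO_log_rpow_atTop hδ).tendsto_div_nhds_zero
      simpa using (ha.add hb).const_mul Q
    obtain ⟨N, hN, hN1⟩ := ((h1.eventually_lt_const one_pos).and (eventually_ge_atTop 1)).exists
    have hN0 : 0 < N := by linarith
    refine ⟨N, hN0, fun n hn => ?_⟩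
    have hlogn := hlog1 (2 * n + 4) (by linarith [n.cast_nonneg (α := ℝ)])
    rw [sub_sub_cancel, lt_div_iff₀ (by linarith)]
    -- As N ≥ 1, 2n + 4 ≤ 2QN + 4 ≤ (2Q + 4)N.
    have h2 : Real.log (2 * n + 4) ≤ Real.log (2 * Q + 4) + Real.log N := by
      rw [← Real.log_mul (by positivity) hN0.ne']
      exact Real.log_le_log (by positivity) (by nlinarith)
    refine lt_of_le_of_lt ?_ hN
    rw [div_eq_mul_inv, ← Real.rpow_neg hN0.le, mul_assoc]
    have : 0 ≤ N ^ (-δ) := Real.rpow_nonneg hN0.le _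
    nlinarith [mul_le_mul_of_nonneg_left h2 this, mul_le_mul_of_nonneg_left
      (mul_le_mul_of_nonneg_left h2 this) hQ]

/-- If `y` is `q`-summable for some `q < P` and the `P`-th power sums of `y` over the sets of
size `n` are at most `d n`, where `d` tends slowly to one, then the whole sum is less than one. -/
theorem tsum_rpow_lt_one_of_slowlyToOne {Γ : Type*} {d : ℕ → ℝ} (hd : SlowlyToOne d) {y : Γ → ℝ}
    {q P : ℝ} (hq : 0 < q) (hqP : q < P) (hyq : Summable fun γ => |y γ| ^ q)
    (hy : ∀ A : Finset Γ, ∑ γ ∈ A, |y γ| ^ P ≤ d A.card) : ∑' γ, |y γ| ^ P < 1 := by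
  classical
  have hnn : ∀ γ, 0 ≤ |y γ| ^ q := fun γ => by positivity
  set Q := ∑' γ, |y γ| ^ q with hQ
  have hQ0 : 0 ≤ Q := tsum_nonneg hnn
  -- The exponent comes from |y|^P = (|y|^q)^((P - q)/q) |y|^q, used where |y|^q < 1/N; the other
  -- coordinates number at most QN by Chebyshev's inequality.
  obtain ⟨N, hN, hNd⟩ := hd Q ((P - q) / q) hQ0 (div_pos (by linarith) hq)
  have hfin : {γ | ¬ |y γ| ^ q < N⁻¹}.Finite :=
    hyq.tendsto_cofinite_zero.eventually_lt_const (inv_pos.2 hN)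
  set A := hfin.toFinset with hA
  have hmem : ∀ γ, γ ∈ A ↔ N⁻¹ ≤ |y γ| ^ q := fun γ => by simp [hA]
  have hcard : (A.card : ℝ) ≤ Q * N := by
    have h1 : A.card • N⁻¹ ≤ ∑ γ ∈ A, |y γ| ^ q :=
      Finset.card_nsmul_le_sum _ _ _ fun γ hγ => (hmem γ).1 hγ
    have h2 : ∑ γ ∈ A, |y γ| ^ q ≤ Q := hyq.sum_le_tsum A fun γ _ => hnn γ
    rw [nsmul_eq_mul, ← div_eq_mul_inv] at h1
    exact (div_le_iff₀ hN).1 (h1.trans h2)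
  have hsmall : ∀ γ ∉ A, |y γ| ^ P ≤ N ^ (-((P - q) / q)) * |y γ| ^ q := by
    intro γ hγ
    rw [hmem, not_le] at hγ
    rcases (abs_nonneg (y γ)).eq_or_lt with h0 | h0
    · rw [← h0, Real.zero_rpow (by linarith), Real.zero_rpow hq.ne', mul_zero]
    · have : |y γ| ^ P = (|y γ| ^ q) ^ ((P - q) / q) * |y γ| ^ q := by
        rw [← Real.rpow_mul h0.le, ← Real.rpow_add h0]
        congr 1
        field_simp
        ring
      rw [this]
      refine mul_le_mul_of_nonneg_right ?_ (hnn γ)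
      rw [Real.rpow_neg hN.le, ← Real.inv_rpow hN.le]
      exact Real.rpow_le_rpow (hnn γ) hγ.le (div_nonneg (by linarith) hq.le)
  refine lt_of_le_of_lt (Real.tsum_le_of_sum_le (fun γ => by positivity) fun F => ?_)
    (show d A.card + Q * N ^ (-((P - q) / q)) < 1 by linarith [hNd _ hcard])
  rw [← Finset.sum_inter_add_sum_sdiff F A]
  refine add_le_add ((Finset.sum_le_sum_of_subset_of_nonneg Finset.inter_subset_right
    fun γ _ _ => by positivity).trans (hy A)) ?_
  calc ∑ γ ∈ F \ A, |y γ| ^ P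
      ≤ ∑ γ ∈ F \ A, N ^ (-((P - q) / q)) * |y γ| ^ q :=
        Finset.sum_le_sum fun γ hγ => hsmall γ (Finset.mem_sdiff.1 hγ).2
    _ = N ^ (-((P - q) / q)) * ∑ γ ∈ F \ A, |y γ| ^ q := (Finset.mul_sum _ _ _).symm
    _ ≤ N ^ (-((P - q) / q)) * Q :=
        mul_le_mul_of_nonneg_left (hyq.sum_le_tsum _ fun γ _ => hnn γ)
          (Real.rpow_nonneg hN.le _)
    _ = Q * N ^ (-((P - q) / q)) := mul_comm _ _

/-! ### The smooth LFC norm on subspaces of 𝒴_p -/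

theorem convexOn_monotone_comp_sub {X : Type*} [AddCommGroup X] [Module ℝ X] {ψ : ℝ → ℝ}
    (hψ : ConvexOn ℝ univ ψ) (hmono : Monotone ψ) {H : X → ℝ} (hH : ConvexOn ℝ univ H) (c : ℝ) :
    ConvexOn ℝ univ fun x => ψ (H x - c) := by
  refine ⟨convex_univ, fun x _ y _ a b ha hb hab => ?_⟩
  refine (hmono ?_).trans (hψ.2 (mem_univ (H x - c)) (mem_univ (H y - c)) ha hb hab)
  have h1 := hH.2 (mem_univ x) (mem_univ y) ha hb hab
  have h2 : a * c + b * c = c := by rw [← add_mul, hab, one_mul]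
  simp only [smul_eq_mul] at h1 ⊢
  linarith

/-- Evaluation at a coordinate on a subspace of `ℓ_p(Γ)`. -/
noncomputable def coordCLM {Γ : Type u} {p : ENNReal} [Fact (1 ≤ p)]
    (R : Submodule ℝ (lp (fun _ : Γ => ℝ) p)) (γ : Γ) : R →L[ℝ] ℝ :=
  (lp.evalCLM ℝ (fun _ : Γ => ℝ) p γ).comp R.subtypeL

theorem coordCLM_apply {Γ : Type u} {p : ENNReal} [Fact (1 ≤ p)]
    (R : Submodule ℝ (lp (fun _ : Γ => ℝ) p)) (γ : Γ) (x : R) :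
    coordCLM R γ x = (x : lp (fun _ : Γ => ℝ) p) γ := rfl

/-- If the power sums of `y` over the sets of size `n` are at most `d n` and the whole power sum
is below one, then near `y` the power sums over all sets `A` that are not contained in a certain
finite set are below a number strictly between `d (n - 1)` and `c n`, where `n` is the size of
`A`. -/
theorem eventually_sum_rpow_le {Γ : Type u} {p : ENNReal} [Fact (1 ≤ p)] (hp : p ≠ ⊤)
    {R : Submodule ℝ (lp (fun _ : Γ => ℝ) p)} {c d : ℕ → ℝ} (hd : Monotone d)
    (hdc : ∀ n, d n < c (n + 1)) (hd1 : Tendsto d atTop (𝓝 1)) {y : R}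
    (hy : ∀ A : Finset Γ, ∑ γ ∈ A, |coordCLM R γ y| ^ p.toReal ≤ d A.card) (hy1 : ‖y‖ < 1) :
    ∃ E : Finset Γ, ∀ᶠ z : R in 𝓝 y, ‖z‖ ≤ 1 ∧ ∀ A : Finset Γ, ¬ A ⊆ E → ∀ m, A.card = m + 1 →
      ∑ γ ∈ A, |coordCLM R γ z| ^ p.toReal ≤ (d m + c (m + 1)) / 2 := by
  classical
  set P := p.toReal with hPdef
  have hP : 0 < P := ENNReal.toReal_pos (zero_lt_one.trans_le Fact.out).ne' hp
  let S : Finset Γ → R → ℝ := fun A x => ∑ γ ∈ A, |coordCLM R γ x| ^ P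
  have hScont : ∀ A, Continuous (S A) := fun A => continuous_finsetSum _ fun γ _ =>
    ((coordCLM R γ).continuous.abs).rpow_const fun _ => Or.inr hP.le
  have hSle : ∀ A x, S A x ≤ ‖x‖ ^ P := fun A x =>
    lp.sum_rpow_le_norm_rpow hP (x : lp (fun _ : Γ => ℝ) p) A
  have hsum : HasSum (fun γ => |coordCLM R γ y| ^ P) (‖y‖ ^ P) :=
    lp.hasSum_norm hP (y : lp (fun _ : Γ => ℝ) p)
  have hs1 : ‖y‖ ^ P < 1 := Real.rpow_lt_one (norm_nonneg _) hy1 hP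
  obtain ⟨s, hs, hs'⟩ := exists_between hs1
  -- For m ≥ n₀ the bound ‖z‖ ^ P < s < d m already suffices; only finitely many gaps remain, so one
  -- τ serves them all.
  obtain ⟨n₀, hn₀⟩ := eventually_atTop.1 (hd1.eventually_const_lt hs')
  obtain ⟨τ, hτ0, hτ⟩ : ∃ τ : ℝ, 0 < τ ∧ ∀ m ∈ Finset.range n₀, 4 * τ < c (m + 1) - d m := by
    have h : ∀ᶠ τ : ℝ in 𝓝[>] 0, ∀ m ∈ Finset.range n₀, 4 * τ < c (m + 1) - d m := by
      rw [Filter.eventually_all_finset]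
      intro m _
      refine eventually_nhdsWithin_of_eventually_nhds ?_
      refine ((continuous_const.mul continuous_id).tendsto (0 : ℝ)).eventually_lt_const ?_
      simpa using hdc m
    obtain ⟨τ, h1, h2⟩ := (h.and self_mem_nhdsWithin).exists
    exact ⟨τ, h2, h1⟩
  obtain ⟨E, hE⟩ := (hsum.eventually_const_lt (show ‖y‖ ^ P - τ < ‖y‖ ^ P by linarith)).exists
  have hnormP : Continuous fun z : R => ‖z‖ ^ P :=
    continuous_norm.rpow_const fun _ => Or.inr hP.le
  refine ⟨E, ?_⟩
  have e1 : ∀ᶠ z : R in 𝓝 y, ‖z‖ ^ P < s := hnormP.continuousAt.eventually_lt_const hs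
  have e2 : ∀ᶠ z : R in 𝓝 y, ‖z‖ ^ P - S E z < τ :=
    (hnormP.sub (hScont E)).continuousAt.eventually_lt_const
      (show ‖y‖ ^ P - S E y < τ by change ‖y‖ ^ P - τ < S E y at hE; linarith)
  have e3 : ∀ᶠ z : R in 𝓝 y, ∀ A ∈ E.powerset, S A z < S A y + τ := by
    rw [Filter.eventually_all_finset]
    intro A _
    exact (hScont A).continuousAt.eventually_lt_const (by linarith)
  have e4 : ∀ᶠ z : R in 𝓝 y, ‖z‖ < 1 := continuous_norm.continuousAt.eventually_lt_const hy1
  filter_upwards [e1, e2, e3, e4] with z h1 h2 h3 h4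
  refine ⟨h4.le, fun A hA m hm => ?_⟩
  change S A z ≤ _
  rcases le_or_gt n₀ m with hnm | hnm
  · have := hn₀ m hnm
    have := hSle A z
    have := hdc m
    linarith
  · have hτm := hτ m (Finset.mem_range.2 hnm)
    have hsplit : S A z = S (A ∩ E) z + S (A \ E) z :=
      (Finset.sum_inter_add_sum_sdiff A E _).symm
    have h5 : S (A \ E) z + S E z ≤ ‖z‖ ^ P := by
      have : S (A \ E) z + S E z = S (A \ E ∪ E) z :=
        (Finset.sum_union Finset.sdiff_disjoint).symm
      rw [this]
      exact hSle _ z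
    have h6 := h3 (A ∩ E) (Finset.mem_powerset.2 Finset.inter_subset_right)
    -- The decisive gain: A loses a point outside E, so the threshold d m applies. The final bound
    -- is d m + 2τ, with one τ for moving y to z and one for A \ E.
    have hcard : (A ∩ E).card ≤ m := by
      have : (A ∩ E).card < A.card := Finset.card_lt_card
        ⟨Finset.inter_subset_left, fun h => hA fun x hx => (Finset.mem_inter.1 (h hx)).2⟩
      omega
    have h7 : S (A ∩ E) y ≤ d m := (hy _).trans (hd hcard)
    linarith

theorem norm_lt_one_of_slowlyToOne {Γ : Type u} {p : ENNReal} [Fact (1 ≤ p)] (hp : p ≠ ⊤)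
    {d : ℕ → ℝ} (hd : SlowlyToOne d) {y : lp (fun _ : Γ => ℝ) p} (hyY : y ∈ calY Γ p)
    (hy : ∀ A : Finset Γ, ∑ γ ∈ A, |y γ| ^ p.toReal ≤ d A.card) : ‖y‖ < 1 := by
  have hP : 0 < p.toReal := ENNReal.toReal_pos (zero_lt_one.trans_le Fact.out).ne' hp
  obtain ⟨q, hq0, hqp, hq⟩ := hyY
  have hq' : 0 < q.toReal := ENNReal.toReal_pos hq0.ne' (hqp.trans_le le_top).ne
  have hsum : Summable fun γ => |y γ| ^ q.toReal := hq.summable hq'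
  have h := tsum_rpow_lt_one_of_slowlyToOne hd hq' ((ENNReal.toReal_lt_toReal
    (hqp.trans_le le_top).ne hp).2 hqp) hsum hy
  have h' : ‖y‖ ^ p.toReal < 1 := by rwa [lp.norm_rpow_eq_tsum hP]
  by_contra hcon
  exact absurd h' (not_lt.2 (Real.one_le_rpow (not_lt.1 hcon) hP.le))

/-- Membership in 𝒴_p enters only through `norm_lt_one_of_slowlyToOne`, to verify local finiteness.
-/
theorem admitsSmoothLFCNorm_of_le_calY {Γ : Type u} {p : ENNReal} [Fact (1 ≤ p)] (hp : p ≠ ⊤)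
    {R : Submodule ℝ (lp (fun _ : Γ => ℝ) p)} (hR : R ≤ calY Γ p) : AdmitsSmoothLFCNorm R := by
  classical
  have hP1 : 1 ≤ p.toReal := by
    rw [← ENNReal.toReal_one]
    exact (ENNReal.toReal_le_toReal ENNReal.one_ne_top hp).2 Fact.out
  have hP : 0 < p.toReal := by linarith
  obtain ⟨ψ, hψs, hψm, hψc, hψ0, hψpos⟩ := exists_smooth_convex_cutoff
  obtain ⟨c, d, hc0, hcd, hdc, hd1, hdlim, hdslow⟩ := exists_interlacing_slowlyToOne
  have hdmono : Monotone d := monotone_nat_of_le_succ fun n => ((hdc n).trans (hcd _)).le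
  -- The smoothing error of n terms stays within half the gap between d (n - 1) and c n. Writing n -
  -- 1 + 1 keeps κ 0 positive under truncated subtraction.
  let κ : ℕ → ℝ := fun n => (c (n - 1 + 1) - d (n - 1)) / (2 * (n + 1))
  have hκ : ∀ n, 0 < κ n := fun n => div_pos (sub_pos.2 (hdc _)) (by positivity)
  have hκle : ∀ m : ℕ, ((m + 1 : ℕ) : ℝ) * κ (m + 1) ≤ (c (m + 1) - d m) / 2 := by
    intro m
    have hg : 0 < c (m + 1) - d m := sub_pos.2 (hdc m)
    simp only [κ, Nat.add_sub_cancel]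
    push_cast
    rw [mul_div_assoc', div_le_div_iff₀ (by positivity) two_pos]
    nlinarith
  choose h hs hconv heven hlow hup using
    fun n => exists_smooth_convex_approx_rpow hP1 (hκ n)
  let H : Finset Γ → R → ℝ := fun A x => ∑ γ ∈ A, h A.card (coordCLM R γ x)
  have hSH : ∀ A x, ∑ γ ∈ A, |coordCLM R γ x| ^ p.toReal ≤ H A x := fun A x =>
    Finset.sum_le_sum fun γ _ => hlow _ _
  have hHS : ∀ A x, ‖x‖ ≤ 1 →
      H A x ≤ ∑ γ ∈ A, |coordCLM R γ x| ^ p.toReal + A.card * κ A.card := by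
    intro A x hx
    rw [← nsmul_eq_mul, ← Finset.sum_const, ← Finset.sum_add_distrib]
    refine Finset.sum_le_sum fun γ _ => hup _ _ ?_
    exact (lp.norm_apply_le_norm (zero_lt_one.trans_le Fact.out).ne'
      (x : lp (fun _ : Γ => ℝ) p) γ).trans hx
  -- Normalised so that φ_A reaches 2 when H A reaches d; any value above 1 would do.
  let K : ℕ → ℝ := fun n => 2 / ψ (d n - c n)
  have hK : ∀ n, 0 < K n := fun n => div_pos two_pos (hψpos _ (sub_pos.2 (hcd n)))
  let φ : Finset Γ → R → ℝ := fun A x => K A.card * ψ (H A x - c A.card)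
  have hφ0 : ∀ A x, H A x ≤ c A.card → φ A x = 0 := fun A x hx => by
    simp only [φ, hψ0 _ (sub_nonpos.2 hx), mul_zero]
  have hφ1 : ∀ A x, φ A x ≤ 1 → H A x < d A.card := by
    intro A x hx
    by_contra hcon
    have h1 : ψ (d A.card - c A.card) ≤ ψ (H A x - c A.card) :=
      hψm (sub_le_sub_right (not_lt.1 hcon) _)
    have h2 := mul_le_mul_of_nonneg_left h1 (hK A.card).le
    have h3 : K A.card * ψ (d A.card - c A.card) = 2 :=
      div_mul_cancel₀ _ (hψpos _ (sub_pos.2 (hcd _))).ne'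
    have h4 : K A.card * ψ (H A x - c A.card) ≤ 1 := hx
    linarith
  have hsmall : ∀ (A : Finset Γ) (x : R) (m : ℕ), ‖x‖ ≤ 1 → A.card = m + 1 →
      ∑ γ ∈ A, |coordCLM R γ x| ^ p.toReal ≤ (d m + c (m + 1)) / 2 → φ A x = 0 := by
    intro A x m hx hm hle
    refine hφ0 A x ((hHS A x hx).trans ?_)
    rw [hm]
    linarith [hκle m]
  refine admitsSmoothLFCNorm_of_family φ ?_ ?_ ?_ ?_ ?_ ?_ ?_
  · intro A
    refine ConvexOn.smul (hK _).le (convexOn_monotone_comp_sub hψc hψm ?_ _)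
    refine ⟨convex_univ, fun x _ y _ a b ha hb hab => ?_⟩
    simp only [H, smul_eq_mul, Finset.mul_sum, ← Finset.sum_add_distrib, map_add, map_smul]
    exact Finset.sum_le_sum fun γ _ => (hconv _).2 (mem_univ _) (mem_univ _) ha hb hab
  · intro A x
    simp [φ, H, heven]
  -- H A 0 may be positive because of the smoothing, but it stays below c.
  · intro A
    obtain hA | ⟨m, hm⟩ : A.card = 0 ∨ ∃ m, A.card = m + 1 := by
      rcases A.card with _ | m
      exacts [Or.inl rfl, Or.inr ⟨m, rfl⟩]
    · refine hφ0 A 0 ?_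
      rw [Finset.card_eq_zero] at hA
      simpa [hA, H] using hc0 0
    · refine hsmall A 0 m (by simp) hm ?_
      have h1 : 0 ≤ d m := (hc0 m).trans (hcd m).le
      simp only [map_zero, abs_zero, Real.zero_rpow hP.ne', Finset.sum_const_zero]
      linarith [hc0 (m + 1)]
  · intro A x
    refine mul_nonneg (hK _).le ?_
    rw [← hψ0 (min 0 (H A x - c A.card)) (min_le_left _ _)]
    exact hψm (min_le_right _ _)
  · intro A
    have hH : FactorsSmoothly (H A) :=
      FactorsSmoothly.sum A fun γ _ => (FactorsSmoothly.clm (coordCLM R γ)).comp (hs A.card)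
    exact hH.comp (h := fun t => K A.card * ψ (t - c A.card))
      (contDiff_const.mul (hψs.comp (contDiff_id.sub contDiff_const)))
  · intro y hy
    have hyd : ∀ A : Finset Γ, ∑ γ ∈ A, |coordCLM R γ y| ^ p.toReal ≤ d A.card := fun A =>
      (hSH A y).trans (hφ1 A y (hy A)).le
    obtain ⟨E, hE⟩ := eventually_sum_rpow_le hp hdmono hdc hdlim hyd
      (norm_lt_one_of_slowlyToOne hp hdslow (hR y.2) hyd)
    refine ⟨E.powerset, hE.mono fun z hz A hA => ?_⟩
    rw [Finset.mem_powerset] at hA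
    have hne : A.card ≠ 0 := fun h0 => hA (by simp [Finset.card_eq_zero.1 h0])
    obtain ⟨m, hm⟩ := Nat.exists_eq_succ_of_ne_zero hne
    exact hsmall A z m hz.1 hm (hz.2 A hA m hm)
  · intro y hy
    refine lp.norm_le_of_forall_sum_le hP zero_le_one fun A => ?_
    rw [Real.one_rpow]
    exact (hSH A y).trans ((hφ1 A y (hy A)).le.trans (hd1 _).le)

/-! ### Operator ranges and the inclusion of ℓ_1 -/

theorem isOperatorRange_range {Z Y : Type u} [NormedAddCommGroup Z] [NormedSpace ℝ Z]
    [CompleteSpace Z] [NormedAddCommGroup Y] [NormedSpace ℝ Y] (T : Z →L[ℝ] Y) :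
    IsOperatorRange T.range :=
  ⟨Z, _, _, inferInstance, T.rangeRestrict, fun ⟨_, x, hx⟩ => ⟨x, Subtype.ext hx⟩⟩

/-- Serves the space ℓ_∞ of sequences, which must be lifted to the universe of Γ. -/
theorem isOperatorRange_range_of_small {Z : Type} {Y : Type u} [NormedAddCommGroup Z]
    [NormedSpace ℝ Z] [CompleteSpace Z] [NormedAddCommGroup Y] [NormedSpace ℝ Y] (T : Z →L[ℝ] Y) :
    IsOperatorRange T.range :=
  ⟨ULift.{u} Z, inferInstance, inferInstance, inferInstance,
    T.rangeRestrict.comp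
      ((ContinuousLinearEquiv.ulift : ULift.{u} Z ≃L[ℝ] Z) : ULift.{u} Z →L[ℝ] Z),
    fun ⟨_, x, hx⟩ => ⟨ULift.up x, Subtype.ext hx⟩⟩

section Lp

variable {Γ : Type u} {p : ENNReal} [Fact (1 ≤ p)]

theorem dense_of_forall_single_mem [DecidableEq Γ] (hp : p ≠ ⊤)
    {R : Submodule ℝ (lp (fun _ : Γ => ℝ) p)}
    (hR : ∀ γ, lp.single p γ (1 : ℝ) ∈ R) : Dense (R : Set (lp (fun _ : Γ => ℝ) p)) := by
  intro f
  refine mem_closure_of_tendsto (lp.hasSum_single hp f) (Eventually.of_forall fun s => ?_)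
  refine R.sum_mem fun γ _ => ?_
  have : lp.single p γ (f γ) = f γ • lp.single (E := fun _ : Γ => ℝ) p γ (1 : ℝ) := by
    rw [← lp.single_smul, smul_eq_mul, mul_one]
  rw [this]
  exact R.smul_mem _ (hR γ)

/-- The inclusion of `ℓ_1(Γ)` into `ℓ_p(Γ)`. -/
theorem exists_inclusion_ell_one (hp : p ≠ ⊤) :
    ∃ T : lp (fun _ : Γ => ℝ) 1 →L[ℝ] lp (fun _ : Γ => ℝ) p,
      ∀ (x : lp (fun _ : Γ => ℝ) 1) (γ : Γ), T x γ = x γ := by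
  have h1 : (1 : ENNReal) ≤ p := Fact.out
  have hP1 : 1 ≤ p.toReal := by
    rw [← ENNReal.toReal_one]
    exact (ENNReal.toReal_le_toReal ENNReal.one_ne_top hp).2 h1
  have hP : 0 < p.toReal := by linarith
  refine ⟨(lp.linearMapOfLE ℝ (fun _ : Γ => ℝ) h1).mkContinuous 1 fun x => ?_, fun x γ => rfl⟩
  rw [one_mul]
  refine lp.norm_le_of_forall_sum_le hP (norm_nonneg _) fun A => ?_
  rw [lp.coe_linearMapOfLE_apply]
  -- One factor |x(γ)| is summed and the remaining power is bounded by that of ‖x‖_1.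
  have hpow : ∀ t : ℝ, 0 ≤ t → t ^ p.toReal = t * t ^ (p.toReal - 1) := fun t ht => by
    rw [← Real.rpow_one_add' ht (by linarith)]
    congr 1
    ring
  calc ∑ γ ∈ A, ‖x γ‖ ^ p.toReal = ∑ γ ∈ A, ‖x γ‖ * ‖x γ‖ ^ (p.toReal - 1) :=
        Finset.sum_congr rfl fun γ _ => hpow _ (norm_nonneg _)
    _ ≤ ∑ γ ∈ A, ‖x γ‖ * ‖x‖ ^ (p.toReal - 1) := by
        refine Finset.sum_le_sum fun γ _ => mul_le_mul_of_nonneg_left ?_ (norm_nonneg _)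
        exact Real.rpow_le_rpow (norm_nonneg _) (lp.norm_apply_le_norm one_ne_zero x γ)
          (by linarith)
    _ = (∑ γ ∈ A, ‖x γ‖) * ‖x‖ ^ (p.toReal - 1) := (Finset.sum_mul _ _ _).symm
    _ ≤ ‖x‖ * ‖x‖ ^ (p.toReal - 1) := by
        refine mul_le_mul_of_nonneg_right ?_ (Real.rpow_nonneg (norm_nonneg _) _)
        simpa using lp.sum_rpow_le_norm_rpow (by simp) x A
    _ = ‖x‖ ^ p.toReal := (hpow _ (norm_nonneg _)).symm

theorem inclusion_ell_one_range (hp : p ≠ ⊤) (hp1 : 1 < p)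
    {T : lp (fun _ : Γ => ℝ) 1 →L[ℝ] lp (fun _ : Γ => ℝ) p}
    (hT : ∀ (x : lp (fun _ : Γ => ℝ) 1) (γ : Γ), T x γ = x γ) :
    T.range ≤ calY Γ p ∧ Dense (T.range : Set (lp (fun _ : Γ => ℝ) p)) := by
  classical
  constructor
  · rintro _ ⟨x, rfl⟩
    refine ⟨1, one_pos, hp1, ?_⟩
    have : (⇑(T x) : Γ → ℝ) = x := funext (hT x)
    change Memℓp (⇑(T x)) 1
    rw [this]
    exact lp.memℓp x
  · refine dense_of_forall_single_mem hp fun γ => ⟨lp.single 1 γ 1, ?_⟩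
    exact lp.ext (funext fun γ' => (hT _ _).trans (by simp only [lp.coeFn_single]))

theorem memℓp_half_mem_calY {f : lp (fun _ : Γ => ℝ) 1} (hf : Memℓp f 2⁻¹) : f ∈ calY Γ 1 :=
  ⟨2⁻¹, by simp, by simp [ENNReal.inv_lt_one], hf⟩

end Lp

/-! ### The weighted operator from ℓ_∞ when p = 1 -/

section Weighted

variable {Γ : Type u} {ι : Type*}

/-- Injectivity of `w` makes the square roots of the weights a subfamily of a geometric series. A
general `w` covers both an enumeration by ℕ+ and a countable, possibly finite, Γ. -/
theorem memℓp_half_geometric_mul (e : ι ≃ Γ) {w : ι → ℕ} (hw : Function.Injective w)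
    (x : lp (fun _ : ι => ℝ) ⊤) :
    Memℓp (fun γ => (2⁻¹ : ℝ) ^ w (e.symm γ) * x (e.symm γ)) 2⁻¹ := by
  refine memℓp_gen ?_
  have hr : (2⁻¹ : ENNReal).toReal = (2⁻¹ : ℝ) := by simp
  rw [hr]
  have hgeo : Summable fun n : ℕ => ((2⁻¹ : ℝ) ^ (2⁻¹ : ℝ)) ^ n :=
    summable_geometric_of_lt_one (by positivity)
      (Real.rpow_lt_one (by norm_num) (by norm_num) (by norm_num))
  have h := (hgeo.comp_injective (hw.comp e.symm.injective)).mul_right (‖x‖ ^ (2⁻¹ : ℝ))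
  refine Summable.of_nonneg_of_le (fun γ => by positivity) (fun γ => ?_) h
  rw [norm_mul, Real.mul_rpow (norm_nonneg _) (norm_nonneg _), norm_pow,
    Real.norm_of_nonneg (by norm_num), ← Real.rpow_pow_comm (by norm_num)]
  refine mul_le_mul_of_nonneg_left ?_ (by positivity)
  exact Real.rpow_le_rpow (norm_nonneg _) (lp.norm_apply_le_norm ENNReal.top_ne_zero x _)
    (by norm_num)

/-- The operator of multiplication by distinct powers of `1/2`, from `ℓ_∞` to `ℓ_1(Γ)`. -/
theorem exists_geometric_mul_operator (e : ι ≃ Γ) {w : ι → ℕ} (hw : Function.Injective w) :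
    ∃ T : lp (fun _ : ι => ℝ) ⊤ →L[ℝ] lp (fun _ : Γ => ℝ) 1,
      ∀ x γ, T x γ = (2⁻¹ : ℝ) ^ w (e.symm γ) * x (e.symm γ) := by
  have hle : (2⁻¹ : ENNReal) ≤ 1 := by simp
  have hgeo : Summable fun γ => (2⁻¹ : ℝ) ^ w (e.symm γ) :=
    (summable_geometric_of_lt_one (by norm_num) (by norm_num)).comp_injective
      (hw.comp e.symm.injective)
  let T : lp (fun _ : ι => ℝ) ⊤ →ₗ[ℝ] lp (fun _ : Γ => ℝ) 1 :=
    { toFun := fun x => ⟨fun γ => (2⁻¹ : ℝ) ^ w (e.symm γ) * x (e.symm γ),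
        (memℓp_half_geometric_mul e hw x).of_exponent_ge hle⟩
      map_add' := fun x y => lp.ext (funext fun γ => mul_add _ _ _)
      map_smul' := fun a x => lp.ext (funext fun γ => mul_left_comm _ _ _) }
  have hT : ∀ x γ, T x γ = (2⁻¹ : ℝ) ^ w (e.symm γ) * x (e.symm γ) := fun x γ => rfl
  refine ⟨T.mkContinuous (∑' γ, (2⁻¹ : ℝ) ^ w (e.symm γ)) fun x => ?_, hT⟩
  have hC : 0 ≤ ∑' γ, (2⁻¹ : ℝ) ^ w (e.symm γ) := tsum_nonneg fun γ => by positivity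
  refine lp.norm_le_of_forall_sum_le (by simp) (mul_nonneg hC (norm_nonneg _)) fun A => ?_
  simp only [ENNReal.toReal_one, Real.rpow_one, hT]
  calc ∑ γ ∈ A, ‖(2⁻¹ : ℝ) ^ w (e.symm γ) * x (e.symm γ)‖
      ≤ ∑ γ ∈ A, (2⁻¹ : ℝ) ^ w (e.symm γ) * ‖x‖ := by
        refine Finset.sum_le_sum fun γ _ => ?_
        rw [norm_mul, Real.norm_of_nonneg (by positivity)]
        exact mul_le_mul_of_nonneg_left (lp.norm_apply_le_norm ENNReal.top_ne_zero x _)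
          (by positivity)
    _ = (∑ γ ∈ A, (2⁻¹ : ℝ) ^ w (e.symm γ)) * ‖x‖ := (Finset.sum_mul _ _ _).symm
    _ ≤ _ := mul_le_mul_of_nonneg_right (hgeo.sum_le_tsum A fun γ _ => by positivity)
        (norm_nonneg _)

theorem geometric_mul_operator_range (e : ι ≃ Γ) {w : ι → ℕ} (hw : Function.Injective w)
    {T : lp (fun _ : ι => ℝ) ⊤ →L[ℝ] lp (fun _ : Γ => ℝ) 1}
    (hT : ∀ x γ, T x γ = (2⁻¹ : ℝ) ^ w (e.symm γ) * x (e.symm γ)) :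
    (∀ y ∈ T.range, Memℓp (y : Γ → ℝ) 2⁻¹) ∧
      Dense (T.range : Set (lp (fun _ : Γ => ℝ) 1)) := by
  classical
  constructor
  · rintro _ ⟨x, rfl⟩
    have : (⇑(T x) : Γ → ℝ) = _ := funext (hT x)
    change Memℓp (⇑(T x)) 2⁻¹
    rw [this]
    exact memℓp_half_geometric_mul e hw x
  · refine dense_of_forall_single_mem ENNReal.one_ne_top fun γ =>
      ⟨(2 : ℝ) ^ w (e.symm γ) • lp.single ⊤ (e.symm γ) (1 : ℝ), ?_⟩
    refine lp.ext (funext fun γ' => (hT _ _).trans ?_)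
    rw [lp.coeFn_smul, Pi.smul_apply, smul_eq_mul]
    by_cases h : γ' = γ
    · subst h
      rw [lp.single_apply_self, lp.single_apply_self, mul_one, ← mul_pow]
      norm_num
    · rw [lp.single_apply_ne _ _ _ h, lp.single_apply_ne _ _ _ (e.symm.injective.ne h)]
      simp

end Weighted

/-! ### Assembly of the three assertions -/

theorem mainTheorem3 (Γ : Type u) :
    -- existence of the dense operator range
    (∀ (p : ENNReal) [Fact (1 ≤ p)], p ≠ ⊤ → (1 < p ∨ (p = 1 ∧ Countable Γ)) →
      ∃ R : Submodule ℝ (lp (fun _ : Γ => ℝ) p),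
        R ≤ calY Γ p ∧ Dense (R : Set (lp (fun _ : Γ => ℝ) p)) ∧
        IsOperatorRange R ∧ AdmitsSmoothLFCNorm R) ∧
    -- the range for `p > 1`: the image of the inclusion of `ℓ_1(Γ)`
    (∀ (p : ENNReal) [Fact (1 ≤ p)], p ≠ ⊤ → 1 < p →
      ∃ T : lp (fun _ : Γ => ℝ) 1 →L[ℝ] lp (fun _ : Γ => ℝ) p,
        (∀ (x : lp (fun _ : Γ => ℝ) 1) (γ : Γ), T x γ = x γ) ∧
        Function.Injective T ∧ T.range ≤ calY Γ p ∧
        Dense (T.range : Set (lp (fun _ : Γ => ℝ) p)) ∧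
        IsOperatorRange T.range ∧ AdmitsSmoothLFCNorm T.range) ∧
    -- the range for `p = 1` and `Γ` countably infinite, enumerated in any way by `e`:
    -- the image of `ℓ_∞` under `x ↦ (2 ^ (-j) * x j)`, which lies in `ℓ_{1/2}(Γ) ⊆ 𝒴_1`
    ((∀ f : Γ → ℝ, Memℓp f 2⁻¹ → ∃ y ∈ calY Γ 1, (y : Γ → ℝ) = f) ∧
      ∀ e : ℕ+ ≃ Γ,
        ∃ T : lp (fun _ : ℕ+ => ℝ) ⊤ →L[ℝ] lp (fun _ : Γ => ℝ) 1,
          (∀ (x : lp (fun _ : ℕ+ => ℝ) ⊤) (j : ℕ+), T x (e j) = (2⁻¹ : ℝ) ^ (j : ℕ) * x j) ∧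
          Function.Injective T ∧ (∀ y ∈ T.range, Memℓp (y : Γ → ℝ) 2⁻¹) ∧
          T.range ≤ calY Γ 1 ∧
          Dense (T.range : Set (lp (fun _ : Γ => ℝ) 1)) ∧
          IsOperatorRange T.range ∧ AdmitsSmoothLFCNorm T.range) := by
  have hii : ∀ (p : ENNReal) [Fact (1 ≤ p)], p ≠ ⊤ → 1 < p →
      ∃ T : lp (fun _ : Γ => ℝ) 1 →L[ℝ] lp (fun _ : Γ => ℝ) p,
        (∀ (x : lp (fun _ : Γ => ℝ) 1) (γ : Γ), T x γ = x γ) ∧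
        Function.Injective T ∧ T.range ≤ calY Γ p ∧
        Dense (T.range : Set (lp (fun _ : Γ => ℝ) p)) ∧
        IsOperatorRange T.range ∧ AdmitsSmoothLFCNorm T.range := by
    intro p _ hp hp1
    obtain ⟨T, hT⟩ := exists_inclusion_ell_one (Γ := Γ) hp
    obtain ⟨hTY, hTd⟩ := inclusion_ell_one_range hp hp1 hT
    refine ⟨T, hT, fun x y hxy => lp.ext (funext fun γ => ?_), hTY, hTd,
      isOperatorRange_range T, admitsSmoothLFCNorm_of_le_calY hp hTY⟩
    rw [← hT, hxy, hT]
  refine ⟨?_, hii, ?_, ?_⟩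
  · rintro p _ hp (hp1 | ⟨rfl, hΓ⟩)
    · obtain ⟨T, -, -, hTY, hTd, hTo, hTn⟩ := hii p hp hp1
      exact ⟨T.range, hTY, hTd, hTo, hTn⟩
    -- An injection into ℕ replaces the enumeration, so finite Γ needs no separate case.
    · obtain ⟨w, hw⟩ := hΓ.exists_injective_nat
      obtain ⟨T, hT⟩ := exists_geometric_mul_operator (Equiv.refl Γ) hw
      obtain ⟨hTm, hTd⟩ := geometric_mul_operator_range (Equiv.refl Γ) hw hT
      have hTY : T.range ≤ calY Γ 1 := fun y hy => memℓp_half_mem_calY (hTm y hy)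
      exact ⟨T.range, hTY, hTd, isOperatorRange_range T, admitsSmoothLFCNorm_of_le_calY hp hTY⟩
  · intro f hf
    exact ⟨⟨f, hf.of_exponent_ge (by simp)⟩, memℓp_half_mem_calY hf, rfl⟩
  · intro e
    have hw : Function.Injective fun j : ℕ+ => (j : ℕ) := PNat.coe_injective
    obtain ⟨T, hT⟩ := exists_geometric_mul_operator e hw
    obtain ⟨hTm, hTd⟩ := geometric_mul_operator_range e hw hT
    have hTY : T.range ≤ calY Γ 1 := fun y hy => memℓp_half_mem_calY (hTm y hy)
    have hTe : ∀ (x : lp (fun _ : ℕ+ => ℝ) ⊤) (j : ℕ+), T x (e j) = (2⁻¹ : ℝ) ^ (j : ℕ) * x j :=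
      fun x j => by rw [hT, e.symm_apply_apply]
    refine ⟨T, hTe, fun x y hxy => lp.ext (funext fun j => ?_), hTm, hTY, hTd,
      isOperatorRange_range_of_small T, admitsSmoothLFCNorm_of_le_calY ENNReal.one_ne_top hTY⟩
    have h := hTe x j
    rw [hxy, hTe] at h
    exact (mul_left_cancel₀ (by positivity) h).symm
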